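/- Let $\mathfrak{S}_n$ be the set of permutations $\sigma=\sigma(1)\sigma(2)\cdots\sigma(n)$ of $[n]=\{1,\dots,n\}$. For $\sigma\in\mathfrak{S}_n$ let $\mathrm{exc}(\sigma)$ be the number of $i\in[n]$ with $i<\sigma(i)$; $\mathrm{des}(\sigma)$ the number of $i\in[n-1]$ with $\sigma(i)>\sigma(i+1)$; $\mathrm{dd}(\sigma)$ the number of $i\in[n]$ with $\sigma(i-1)>\sigma(i)>\sigma(i+1)$, where $\sigma(0)=\sigma(n+1)=0$; and $\mathrm{inv}(\sigma)$ the number of pairs $i<j$ in $[n]$ with $\sigma(i)>\sigma(j)$ (always $\mathrm{exc}(\sigma)\le\mathrm{inv}(\sigma)$). Let $(31\text{-}2)\sigma$ be the number of pairs $(i,j)$ with $2\le i<j\le n$ and $\sigma(i-1)>\sigma(j)>\sigma(i)$, and let $(2\text{-}13)\sigma$ be the number of pairs $(i,j)$ with $1\le i<j\le n$ and $\sigma(j)>\sigma(i)>\sigma(j-1)$. Put $DD_{n,k}=\{\sigma\in\mathfrak{S}_n:\mathrm{des}(\sigma)=k,\ \mathrm{dd}(\sigma)=0\}$. **Theorem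 (Shin and Zeng).** For every $n\ge 1$, $$ \sum_{\sigma\in\mathfrak{S}_n}q^{\mathrm{inv}(\sigma)-\mathrm{exc}(\sigma)}t^{\mathrm{exc}(\sigma)} =\sum_{k=0}^{\lfloor (n-1)/2\rfloor}\Bigl(\sum_{\sigma\in DD_{n,k}}q^{2\,(2\text{-}13)\sigma+(31\text{-}2)\sigma}\Bigr)t^k(1+t)^{n-1-2k} $$ as polynomials in $q$ and $t$ (equivalently, for all elements $q,t$ of any commutative semiring). -/

import Mathlib

namespace PermStat

open Finset

/-- The word `σ(1) σ(2) ⋯ σ(n)` of a permutation of `[n] = {1, …, n}`, as a function on `ℕ` with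
values in `ℕ`, extended by `0` outside `[n]`; in particular `σ(0) = σ(n+1) = 0`.
The element `i : Fin n` stands for the element `i + 1` of `[n]`. -/
def word {n : ℕ} (σ : Equiv.Perm (Fin n)) (i : ℕ) : ℕ :=
  if h : 1 ≤ i ∧ i ≤ n then (σ ⟨i - 1, by omega⟩ : ℕ) + 1 else 0

/-- The number of excedances: `i ∈ [n]` with `i < σ(i)`. -/
def exc {n : ℕ} (σ : Equiv.Perm (Fin n)) : ℕ :=
  #{i ∈ Icc 1 n | i < word σ i}

/-- The number of descents: `i ∈ [n-1]` with `σ(i) > σ(i+1)`. -/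
def des {n : ℕ} (σ : Equiv.Perm (Fin n)) : ℕ :=
  #{i ∈ Icc 1 (n - 1) | word σ i > word σ (i + 1)}

/-- The number of double descents: `i ∈ [n]` with `σ(i-1) > σ(i) > σ(i+1)`,
where `σ(0) = σ(n+1) = 0`. -/
def dd {n : ℕ} (σ : Equiv.Perm (Fin n)) : ℕ :=
  #{i ∈ Icc 1 n | word σ (i - 1) > word σ i ∧ word σ i > word σ (i + 1)}

/-- The number of inversions: pairs `i < j` in `[n]` with `σ(i) > σ(j)`. -/
def inv {n : ℕ} (σ : Equiv.Perm (Fin n)) : ℕ :=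
  #{p ∈ Icc 1 n ×ˢ Icc 1 n | p.1 < p.2 ∧ word σ p.1 > word σ p.2}

/-- The statistic `(31-2) σ`: pairs `(i, j)` with `2 ≤ i < j ≤ n` and `σ(i-1) > σ(j) > σ(i)`. -/
def pat31_2 {n : ℕ} (σ : Equiv.Perm (Fin n)) : ℕ :=
  #{p ∈ Icc 2 n ×ˢ Icc 2 n |
    p.1 < p.2 ∧ word σ (p.1 - 1) > word σ p.2 ∧ word σ p.2 > word σ p.1}

/-- The statistic `(2-13) σ`: pairs `(i, j)` with `1 ≤ i < j ≤ n` and `σ(j) > σ(i) > σ(j-1)`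
(the last inequality forces `i < j - 1`). -/
def pat2_13 {n : ℕ} (σ : Equiv.Perm (Fin n)) : ℕ :=
  #{p ∈ Icc 1 n ×ˢ Icc 1 n |
    p.1 < p.2 ∧ word σ p.2 > word σ p.1 ∧ word σ p.1 > word σ (p.2 - 1)}

/-- The set `DD_{n,k}` of permutations of `[n]` with `k` descents and no double descents. -/
def DD (n k : ℕ) : Finset (Equiv.Perm (Fin n)) :=
  {σ | des σ = k ∧ dd σ = 0}

/-- `exc σ ≤ inv σ`, so that the natural-number difference `inv σ - exc σ` is the true one. -/
theorem exc_le_inv {n : ℕ} (σ : Equiv.Perm (Fin n)) : exc σ ≤ inv σ := by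
  classical
  unfold exc inv
  have key : ∀ i ∈ ({i ∈ Icc 1 n | i < word σ i} : Finset ℕ),
      ∃ j, (i, j) ∈ ({p ∈ Icc 1 n ×ˢ Icc 1 n |
        p.1 < p.2 ∧ word σ p.1 > word σ p.2} : Finset (ℕ × ℕ)) := by
    intro i hi
    simp only [mem_filter, mem_Icc] at hi
    obtain ⟨⟨h1, h2⟩, h3⟩ := hi
    by_contra hcon
    push Not at hcon
    have hw : ∀ j (h : j < n), word σ (j + 1) = (σ ⟨j, h⟩ : ℕ) + 1 := by
      intro j h
      unfold word
      rw [dif_pos ⟨by omega, by omega⟩]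
      rfl
    obtain ⟨i, rfl⟩ : ∃ m, i = m + 1 := ⟨i - 1, by omega⟩
    have hin : i < n := by omega
    rw [hw i hin] at h3
    have hall : ∀ j ∈ Ici (⟨i, hin⟩ : Fin n), σ j ∈ Ioi (⟨i, hin⟩ : Fin n) := by
      rintro ⟨j, hj⟩ hij
      simp only [mem_Ici, Fin.mk_le_mk] at hij
      simp only [mem_Ioi, Fin.lt_def]
      rcases Nat.eq_or_lt_of_le hij with rfl | hlt
      · omega
      · have := hcon (j + 1)
        simp only [mem_filter, mem_product, mem_Icc, hw j hj, hw i hin] at this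
        omega
    have hc := Finset.card_le_card_of_injOn σ hall σ.injective.injOn
    simp only [Fin.card_Ici, Fin.card_Ioi] at hc
    omega
  choose! f hf using key
  exact Finset.card_le_card_of_injOn (fun i => (i, f i)) hf
    (fun a _ b _ h => (Prod.mk.inj h).1)

end PermStat

/-!
Both sides are evaluated by iterating an operator on functions `ℕ → R`. On the left, partial
permutation words are grown by alternately adjoining a new value and a new place; the function
argument is the number of places still to be filled. On the right, words are grown value by value,
the argument being the number of slots into which larger values can still go (Françon–Viennot). The
weight of an insertion depends only on which sides of the new letter keep a slot, and summing over
the slots gives `∑ qⁱ (q²)^(k-1-i) = q^(k-1) [k]`. The weights `t` of a valley, `1` of a peak and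
`1 + t` of a double ascent then make the operator conjugate, by a diagonal factor, to the product of
the two steps on the left in the opposite order: the two sides are the even and the odd contraction
of one continued fraction.
-/

namespace PermStat

open Finset

section QInteger

variable {R : Type*} [CommSemiring R]

/-- The `(p, r)`-integer `[k] = ∑ pⁱ r^(k-1-i)`, summed over `0 ≤ i < k`; `qInt 1 q` is the usual
`q`-integer. -/
def qInt (p r : R) : ℕ → R
  | 0 => 0
  | k + 1 => r ^ k + p * qInt p r k

theorem qInt_sq (q : R) (k : ℕ) : qInt q (q ^ 2) (k + 1) = q ^ k * qInt 1 q (k + 1) := by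
  induction k with
  | zero => simp [qInt]
  | succ k ih =>
    rw [qInt, ih, qInt.eq_2 1 q (k + 1)]
    ring

theorem sum_pow_card_filter_lt {α : Type*} [LinearOrder α] (q : R) (s : Finset α) :
    ∑ v ∈ s, q ^ #{c ∈ s | c < v} = qInt 1 q #s := by
  induction s using Finset.induction_on_max with
  | empty => simp [qInt]
  | insert a s ha ih =>
    have has : a ∉ s := fun h => lt_irrefl _ (ha a h)
    have hfilter : ∀ v ≤ a, {c ∈ insert a s | c < v} = {c ∈ s | c < v} := fun v hv => by
      rw [filter_insert, if_neg hv.not_gt]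
    rw [sum_insert has, card_insert_of_notMem has, qInt, one_mul, ← ih, hfilter a le_rfl,
      filter_true_of_mem ha]
    congr 1
    exact sum_congr rfl fun v hv => by rw [hfilter v (ha v hv).le]

end QInteger

section Splits

variable {α : Type*} [DecidableEq α]

/-- The pairs `(x, y)` with `w = x ++ a :: y`, that is, the occurrences of the letter `a` in the
word `w`. -/
def splits (a : α) : List α → Finset (List α × List α)
  | [] => ∅
  | b :: w => (if b = a then {([], w)} else ∅) ∪ (splits a w).image fun z => (b :: z.1, z.2)

theorem mem_splits {a : α} {w : List α} {z : List α × List α} :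
    z ∈ splits a w ↔ z.1 ++ a :: z.2 = w := by
  obtain ⟨x, y⟩ := z
  induction w generalizing x y with
  | nil => simp [splits]
  | cons b w ih => cases x <;> by_cases h : b = a <;> simp [splits, ih, h] <;> grind

/-- The pairs `(x, y)` with `x ++ a :: y ∈ E`: the words of `E` with a marked letter `a`. -/
def markedWords (a : α) (E : Finset (List α)) : Finset (List α × List α) :=
  E.biUnion (splits a)

theorem mem_markedWords {a : α} {E : Finset (List α)} {z : List α × List α} :
    z ∈ markedWords a E ↔ z.1 ++ a :: z.2 ∈ E := by
  simp [markedWords, mem_splits]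

variable {R : Type*} [CommSemiring R]

theorem sum_splits (p r : R) (a : α) (w : List α) :
    ∑ z ∈ splits a w, p ^ z.1.count a * r ^ z.2.count a = qInt p r (w.count a) := by
  induction w with
  | nil => simp [splits, qInt]
  | cons b w ih =>
    have hinj : Function.Injective fun z : List α × List α => (b :: z.1, z.2) := by
      rintro ⟨x, y⟩ ⟨x', y'⟩ h
      simpa using h
    have hdisj : Disjoint (if b = a then {([], w)} else ∅)
        ((splits a w).image fun z => (b :: z.1, z.2)) := by
      split_ifs <;> simp
    rw [splits, sum_union hdisj, sum_image hinj.injOn]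
    by_cases hb : b = a
    · subst hb
      simp [qInt, ← ih, mul_sum, pow_succ', mul_assoc]
    · simp [hb, ih]

theorem sum_markedWords (p r : R) (a : α) (E : Finset (List α)) (G : List α → R) :
    ∑ z ∈ markedWords a E, G (z.1 ++ a :: z.2) * (p ^ z.1.count a * r ^ z.2.count a) =
      ∑ w ∈ E, G w * qInt p r (w.count a) := by
  rw [markedWords, sum_biUnion]
  · refine sum_congr rfl fun w _ => ?_
    rw [← sum_splits, mul_sum]
    exact sum_congr rfl fun z hz => by rw [mem_splits.1 hz]
  · intro w _ w' _ hne
    refine disjoint_left.2 fun z hz hz' => hne ?_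
    rw [← mem_splits.1 hz, mem_splits.1 hz']

end Splits

section Place

/-- The increasing enumeration of the natural numbers different from `c`. -/
def bump (c v : ℕ) : ℕ := if v < c then v else v + 1

variable {c v : ℕ}

theorem bump_of_lt (h : v < c) : bump c v = v := if_pos h

theorem bump_self (c : ℕ) : bump c c = c + 1 := if_neg (lt_irrefl c)

theorem bump_ne (c v : ℕ) : bump c v ≠ c := by
  unfold bump
  split_ifs <;> omega

theorem bump_injective (c : ℕ) : Function.Injective (bump c) := by
  intro a b h
  unfold bump at h
  split_ifs at h <;> omega

theorem exists_bump_eq (h : v ≠ c) : ∃ a, bump c a = v := by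
  rcases h.lt_or_gt with h | h
  · exact ⟨v, bump_of_lt h⟩
  · exact ⟨v - 1, by rw [bump, if_neg (by omega)]; omega⟩

theorem lt_bump_iff {k : ℕ} (h : k < c) : k < bump c v ↔ k < v := by
  unfold bump
  split_ifs <;> omega

theorem bump_mem_Icc (hc : 0 < c) : bump c v ∈ Icc 1 (c + 1) ↔ v ∈ Icc 1 c := by
  unfold bump
  split_ifs <;> simp only [mem_Icc] <;> omega

theorem notMem_map_bump (c : ℕ) (l : List ℕ) : c ∉ l.map (bump c) := by
  simp [bump_ne]

theorem count_map_bump_self (c : ℕ) (l : List ℕ) : (l.map (bump c)).count c = 0 :=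
  List.count_eq_zero.2 (notMem_map_bump c l)

theorem count_succ_map_bump (c : ℕ) (l : List ℕ) :
    (l.map (bump c)).count (c + 1) = l.count c := by
  rw [← bump_self c]
  exact List.count_map_of_injective _ _ (bump_injective c) _

theorem count_map_bump_of_lt (h : v < c) (l : List ℕ) :
    (l.map (bump c)).count v = l.count v := by
  conv_lhs => rw [← bump_of_lt h]
  exact List.count_map_of_injective _ _ (bump_injective c) _

theorem exists_map_bump_eq {l : List ℕ} (h : c ∉ l) : ∃ l' : List ℕ, l'.map (bump c) = l := by
  have hmem : l ∈ Set.range (List.map (bump c)) := by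
    rw [Set.range_list_map]
    exact fun v hv => exists_bump_eq fun hvc => h (hvc ▸ hv)
  exact hmem

/-- The word obtained from `x ++ c :: y`, in which the largest letter `c` stands for values that
are still to be chosen, by giving the marked occurrence the value `c`; the other occurrences are
raised to `c + 1`. -/
def place (c : ℕ) (x y : List ℕ) : List ℕ := x.map (bump c) ++ c :: y.map (bump c)

variable {x y : List ℕ}

theorem place_inj {x' y' : List ℕ} : place c x y = place c x' y' ↔ x = x' ∧ y = y' := by
  rw [place, place,
    List.append_cons_inj_of_notMem (notMem_map_bump c x) (notMem_map_bump c y)]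
  simp [(List.map_injective_iff.2 (bump_injective c)).eq_iff]

theorem exists_place_eq {u : List ℕ} (h : u.count c = 1) : ∃ x y, place c x y = u := by
  obtain ⟨x, y, rfl, hx⟩ := List.eq_append_cons_of_mem (List.count_pos_iff.1 (h ▸ one_pos))
  have hy : c ∉ y := by
    rw [List.count_append, List.count_cons_self, List.count_eq_zero.2 hx] at h
    exact List.count_eq_zero.1 (by omega)
  obtain ⟨x, rfl⟩ := exists_map_bump_eq hx
  obtain ⟨y, rfl⟩ := exists_map_bump_eq hy
  exact ⟨x, y, rfl⟩

theorem length_place (c : ℕ) (x y : List ℕ) : (place c x y).length = (x ++ c :: y).length := by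
  simp [place]

theorem reverse_place (c : ℕ) (x y : List ℕ) :
    (place c x y).reverse = place c y.reverse x.reverse := by
  simp [place]

theorem count_place_self (c : ℕ) (x y : List ℕ) : (place c x y).count c = 1 := by
  simp [place, count_map_bump_self]

theorem count_place_of_lt (h : v < c) (x y : List ℕ) :
    (place c x y).count v = (x ++ c :: y).count v := by
  simp [place, count_map_bump_of_lt h, List.count_cons]

theorem count_succ_place (c : ℕ) (x y : List ℕ) :
    (place c x y).count (c + 1) = x.count c + y.count c := by
  simp [place, count_succ_map_bump]

theorem forall_mem_place (hc : 0 < c) :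
    (∀ v ∈ place c x y, v ∈ Icc 1 (c + 1)) ↔ ∀ v ∈ x ++ c :: y, v ∈ Icc 1 c := by
  have h : c ∈ Icc 1 (c + 1) ↔ c ∈ Icc 1 c := by simp only [mem_Icc]; omega
  simp only [place, List.forall_mem_append, List.forall_mem_cons, List.forall_mem_map,
    bump_mem_Icc hc, h]

end Place

section PartialWords

/-- The partial injections from `a` places to the values `1, …, c - 1`, as words of length `a`:
the letter `c`, which may be repeated, marks the places without a value. -/
def partialWords : ℕ → ℕ → Finset (List ℕ)
  | 0, _ => {[]}
  | a + 1, c => (partialWords a c).biUnion fun l =>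
      (insert c {v ∈ Ico 1 c | v ∉ l}).image (· :: l)

variable {a c : ℕ}

theorem cons_mem_partialWords {v : ℕ} {l : List ℕ} :
    v :: l ∈ partialWords (a + 1) c ↔
      l ∈ partialWords a c ∧ (v = c ∨ v ∈ Ico 1 c ∧ v ∉ l) := by
  simp only [partialWords, mem_biUnion, mem_image, List.cons.injEq, mem_insert, mem_filter]
  grind

theorem mem_partialWords (hc : 0 < c) {f : List ℕ} :
    f ∈ partialWords a c ↔
      f.length = a ∧ (∀ v ∈ f, v ∈ Icc 1 c) ∧ ∀ v < c, f.count v ≤ 1 := by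
  induction a generalizing f with
  | zero => simp +contextual [partialWords, List.length_eq_zero_iff]
  | succ a ih =>
    cases f with
    | nil => simp [partialWords]
    | cons v l =>
      have hcount : (∀ w < c, (v :: l).count w ≤ 1) ↔
          (v < c → v ∉ l) ∧ ∀ w < c, l.count w ≤ 1 := by
        grind [List.count_eq_zero]
      simp only [cons_mem_partialWords, ih, hcount, List.length_cons, List.forall_mem_cons,
        mem_Ico, mem_Icc]
      grind

theorem sum_partialWords_succ_left {M : Type*} [AddCommMonoid M] (a c : ℕ) (G : List ℕ → M) :
    ∑ f ∈ partialWords (a + 1) c, G f =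
      ∑ l ∈ partialWords a c, (G (c :: l) + ∑ v ∈ Ico 1 c with v ∉ l, G (v :: l)) := by
  rw [partialWords, sum_biUnion]
  · refine sum_congr rfl fun l _ => ?_
    rw [sum_image fun v _ v' _ h => (List.cons.inj h).1, sum_insert (by simp)]
  · intro l _ l' _ hne
    simp only [Function.onFun, disjoint_left, mem_image]
    rintro _ ⟨v, _, rfl⟩ ⟨v', _, h⟩
    exact hne (List.cons.inj h).2.symm

theorem map_bump_mem_partialWords (hc : 0 < c) {l : List ℕ} :
    l.map (bump c) ∈ partialWords a (c + 1) ↔ l ∈ partialWords a c := by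
  have hcount : (∀ v < c + 1, (l.map (bump c)).count v ≤ 1) ↔ ∀ v < c, l.count v ≤ 1 := by
    simp +contextual only [Nat.forall_lt_succ_right, count_map_bump_self, zero_le, and_true,
      count_map_bump_of_lt]
  rw [mem_partialWords hc, mem_partialWords c.succ_pos, hcount, List.forall_mem_map,
    List.length_map]
  simp only [bump_mem_Icc hc]

theorem place_mem_partialWords (hc : 0 < c) {x y : List ℕ} :
    place c x y ∈ partialWords a (c + 1) ↔ x ++ c :: y ∈ partialWords a c := by
  have hcount : (∀ v < c + 1, (place c x y).count v ≤ 1) ↔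
      ∀ v < c, (x ++ c :: y).count v ≤ 1 := by
    simp +contextual only [Nat.forall_lt_succ_right, count_place_self, le_refl, and_true,
      count_place_of_lt]
  rw [mem_partialWords hc, mem_partialWords c.succ_pos, hcount, forall_mem_place hc, length_place]

theorem sum_partialWords_succ_right {M : Type*} [AddCommMonoid M] (a : ℕ) (hc : 0 < c)
    (G : List ℕ → M) :
    ∑ f ∈ partialWords a (c + 1), G f =
      ∑ l ∈ partialWords a c, G (l.map (bump c)) +
        ∑ z ∈ markedWords c (partialWords a c), G (place c z.1 z.2) := by
  have hunion : partialWords a (c + 1) = (partialWords a c).image (List.map (bump c)) ∪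
      (markedWords c (partialWords a c)).image fun z => place c z.1 z.2 := by
    ext f
    simp only [mem_union, mem_image, mem_markedWords, Prod.exists]
    constructor
    · intro hf
      have hle : f.count c ≤ 1 := ((mem_partialWords c.succ_pos).1 hf).2.2 c c.lt_succ_self
      rcases hle.lt_or_eq with h | h
      · obtain ⟨l, rfl⟩ := exists_map_bump_eq (List.count_eq_zero.1 (Nat.lt_one_iff.1 h))
        exact .inl ⟨l, (map_bump_mem_partialWords hc).1 hf, rfl⟩
      · obtain ⟨x, y, rfl⟩ := exists_place_eq h
        exact .inr ⟨x, y, (place_mem_partialWords hc).1 hf, rfl⟩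
    · rintro (⟨l, hl, rfl⟩ | ⟨x, y, hxy, rfl⟩)
      · exact (map_bump_mem_partialWords hc).2 hl
      · exact (place_mem_partialWords hc).2 hxy
  have hdisj : Disjoint ((partialWords a c).image (List.map (bump c)))
      ((markedWords c (partialWords a c)).image fun z => place c z.1 z.2) := by
    simp only [disjoint_left, mem_image]
    rintro _ ⟨l, -, rfl⟩ ⟨z, -, h⟩
    exact notMem_map_bump c l (h ▸ by simp [place])
  rw [hunion, sum_union hdisj, sum_image (List.map_injective_iff.2 (bump_injective c)).injOn,
    sum_image]
  rintro ⟨x, y⟩ - ⟨x', y'⟩ - h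
  exact Prod.ext_iff.2 (place_inj.1 h)

theorem card_filter_notMem_add_length {l : List ℕ} (hc : 0 < c) (hl : l ∈ partialWords a c) :
    #{v ∈ Ico 1 c | v ∉ l} + a = c - 1 + l.count c := by
  induction a generalizing l with
  | zero =>
    obtain rfl : l = [] := by simpa [partialWords] using hl
    simp
  | succ a ih =>
    obtain _ | ⟨v, l⟩ := l
    · simp [partialWords] at hl
    obtain ⟨hl, hv⟩ := cons_mem_partialWords.1 hl
    have := ih hl
    rcases hv with rfl | ⟨hv, hvl⟩
    · have hfilter : {w ∈ Ico 1 v | w ∉ v :: l} = {w ∈ Ico 1 v | w ∉ l} :=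
        filter_congr fun w hw => by simp [(mem_Ico.1 hw).2.ne]
      rw [hfilter, List.count_cons_self]
      omega
    · have hfilter : {w ∈ Ico 1 c | w ∉ v :: l} = {w ∈ Ico 1 c | w ∉ l}.erase v := by
        ext w
        simp only [mem_filter, mem_erase, List.mem_cons]
        tauto
      rw [hfilter, List.count_cons_of_ne (mem_Ico.1 hv).2.ne]
      have := card_erase_add_one (s := {w ∈ Ico 1 c | w ∉ l}) (mem_filter.2 ⟨hv, hvl⟩)
      omega

end PartialWords

section LehmerSum

/-- The sum of the digits of the Lehmer code of a word that is read from right to left: each letter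
`v` counts the smaller positive values that do not occur further to the right in the list. For a
permutation this is the number of inversions. -/
def lehmerSum : List ℕ → ℕ
  | [] => 0
  | v :: l => #{e ∈ Ico 1 v | e ∉ l} + lehmerSum l

/-- The number of letters that exceed their position, where positions are numbered from right to
left, starting at `1`. -/
def excCount : List ℕ → ℕ
  | [] => 0
  | v :: l => (if l.length + 1 < v then 1 else 0) + excCount l

theorem excCount_le_lehmerSum (l : List ℕ) : excCount l ≤ lehmerSum l := by
  induction l with
  | nil => simp [excCount, lehmerSum]
  | cons v l ih =>
    rw [excCount, lehmerSum]
    refine Nat.add_le_add ?_ ih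
    have hcard : (v - 1) - l.length ≤ #{e ∈ Ico 1 v | e ∉ l} := by
      have hsdiff : {e ∈ Ico 1 v | e ∉ l} = Ico 1 v \ l.toFinset := by
        ext e
        simp
      rw [hsdiff, ← Nat.card_Ico 1 v]
      exact (Nat.sub_le_sub_left l.toFinset_card_le _).trans (le_card_sdiff _ _)
    split_ifs <;> omega

variable {c : ℕ}

theorem card_filter_notMem_bump {v : ℕ} {l l' : List ℕ} (hc : 0 < c) (hv : v ≤ c)
    (h : ∀ e < c, e ∈ l' ↔ e ∈ l) :
    #{e ∈ Ico 1 (bump c v) | e ∉ l'} =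
      #{e ∈ Ico 1 v | e ∉ l} + if v = c ∧ c ∉ l' then 1 else 0 := by
  have hcongr : {e ∈ Ico 1 v | e ∉ l'} = {e ∈ Ico 1 v | e ∉ l} :=
    filter_congr fun e he => not_congr (h e ((mem_Ico.1 he).2.trans_le hv))
  rcases hv.lt_or_eq with hv | rfl
  · rw [bump_of_lt hv, hcongr, if_neg fun h => hv.ne h.1, add_zero]
  · rw [bump_self, ← insert_Ico_right_eq_Ico_add_one hc, filter_insert, hcongr]
    by_cases hvl : v ∈ l' <;> simp [hvl]

theorem mem_map_bump_of_lt {e : ℕ} (h : e < c) (l : List ℕ) : e ∈ l.map (bump c) ↔ e ∈ l := by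
  rw [← List.count_pos_iff, count_map_bump_of_lt h, List.count_pos_iff]

theorem mem_place_of_lt {e : ℕ} (h : e < c) (x y : List ℕ) :
    e ∈ place c x y ↔ e ∈ x ++ c :: y := by
  rw [← List.count_pos_iff, count_place_of_lt h, List.count_pos_iff]

theorem lehmerSum_map_bump {l : List ℕ} (hc : 0 < c) (hl : ∀ v ∈ l, v ≤ c) :
    lehmerSum (l.map (bump c)) = lehmerSum l + l.count c := by
  induction l with
  | nil => simp [lehmerSum]
  | cons v l ih =>
    obtain ⟨hv, hl⟩ := List.forall_mem_cons.1 hl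
    rw [List.map_cons, lehmerSum, lehmerSum, ih hl, List.count_cons,
      card_filter_notMem_bump hc hv fun e he => mem_map_bump_of_lt he l]
    simp only [notMem_map_bump, not_false_iff, and_true, beq_iff_eq]
    ring

theorem lehmerSum_place {x y : List ℕ} (hc : 0 < c) (hxy : ∀ v ∈ x ++ c :: y, v ≤ c) :
    lehmerSum (place c x y) = lehmerSum (x ++ c :: y) + y.count c := by
  induction x with
  | nil =>
    have hcard : #{e ∈ Ico 1 c | e ∉ y.map (bump c)} = #{e ∈ Ico 1 c | e ∉ y} := by
      congr 1
      exact filter_congr fun e he => not_congr (mem_map_bump_of_lt (mem_Ico.1 he).2 y)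
    rw [place, List.map_nil, List.nil_append, List.nil_append, lehmerSum, lehmerSum, hcard,
      lehmerSum_map_bump hc (List.forall_mem_cons.1 hxy).2, add_assoc]
  | cons v x ih =>
    obtain ⟨hv, hxy⟩ := List.forall_mem_cons.1 hxy
    have hmem : c ∈ place c x y := by simp [place]
    have hplace : place c (v :: x) y = bump c v :: place c x y := rfl
    rw [hplace, List.cons_append, lehmerSum, lehmerSum, ih hxy,
      card_filter_notMem_bump hc hv fun e he => mem_place_of_lt he x y,
      if_neg fun h => h.2 hmem, add_zero, add_assoc]

theorem excCount_map_bump {l : List ℕ} (h : l.length < c) :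
    excCount (l.map (bump c)) = excCount l := by
  induction l with
  | nil => rfl
  | cons v l ih =>
    rw [List.length_cons] at h
    simp only [List.map_cons, excCount, List.length_map, lt_bump_iff h, ih (Nat.lt_of_succ_lt h)]

theorem excCount_place {x y : List ℕ} (h : (x ++ c :: y).length < c) :
    excCount (place c x y) = excCount (x ++ c :: y) := by
  induction x with
  | nil =>
    have hy : y.length < c := Nat.lt_of_succ_lt h
    simp [place, excCount, excCount_map_bump hy]
  | cons v x ih =>
    have hplace : place c (v :: x) y = bump c v :: place c x y := rfl
    rw [List.cons_append, List.length_cons] at h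
    rw [hplace, List.cons_append, excCount, excCount, length_place, ih (Nat.lt_of_succ_lt h)]
    simp only [lt_bump_iff h]

end LehmerSum

section CodeWeight

variable {R : Type*} [CommSemiring R]

/-- The weight `q ^ (inv - exc) * t ^ exc` of a partial word. -/
def codeWeight (q t : R) (f : List ℕ) : R := q ^ (lehmerSum f - excCount f) * t ^ excCount f

theorem codeWeight_eq_mul_pow (q t : R) {f g : List ℕ} {k : ℕ}
    (hlehmer : lehmerSum g = lehmerSum f + k) (hexc : excCount g = excCount f) :
    codeWeight q t g = codeWeight q t f * q ^ k := by
  rw [codeWeight, codeWeight, hexc, hlehmer, Nat.sub_add_comm (excCount_le_lehmerSum f), pow_add]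
  ring

/-- The effect on `∑ f, codeWeight q t f * F k`, where `k` is the number of places of `f` without a
value, of making a new largest value available. -/
def colStep (q : R) (F : ℕ → R) (k : ℕ) : R := qInt 1 q k * F (k - 1) + q ^ k * F k

/-- The effect on `∑ f, codeWeight q t f * F k`, where `k` is the number of places of `f` without a
value, of adding a place. -/
def rowStep (q t : R) (F : ℕ → R) (k : ℕ) : R :=
  qInt 1 q (k + 1) * F k + t * q ^ k * F (k + 1)

theorem sum_codeWeight_succ_right (q t : R) {a c : ℕ} (hac : a < c) (F : ℕ → R) :
    ∑ f ∈ partialWords a (c + 1), codeWeight q t f * F (f.count (c + 1)) =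
      ∑ f ∈ partialWords a c, codeWeight q t f * colStep q F (f.count c) := by
  have hc : 0 < c := Nat.zero_lt_of_lt hac
  have hle : ∀ f ∈ partialWords a c, f.length < c ∧ ∀ v ∈ f, v ≤ c := fun f hf => by
    obtain ⟨hlen, hmem, -⟩ := (mem_partialWords hc).1 hf
    exact ⟨hlen ▸ hac, fun v hv => (mem_Icc.1 (hmem v hv)).2⟩
  have hmap : ∀ f ∈ partialWords a c,
      codeWeight q t (f.map (bump c)) * F ((f.map (bump c)).count (c + 1)) =
        codeWeight q t f * (q ^ f.count c * F (f.count c)) := fun f hf => by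
    obtain ⟨hlen, hmem⟩ := hle f hf
    rw [codeWeight_eq_mul_pow q t (lehmerSum_map_bump hc hmem) (excCount_map_bump hlen),
      count_succ_map_bump, mul_assoc]
  have hplace : ∀ z ∈ markedWords c (partialWords a c),
      codeWeight q t (place c z.1 z.2) * F ((place c z.1 z.2).count (c + 1)) =
        codeWeight q t (z.1 ++ c :: z.2) * F ((z.1 ++ c :: z.2).count c - 1) *
          (1 ^ z.1.count c * q ^ z.2.count c) := fun z hz => by
    obtain ⟨hlen, hmem⟩ := hle _ (mem_markedWords.1 hz)
    have hcount : (z.1 ++ c :: z.2).count c - 1 = z.1.count c + z.2.count c := by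
      simp only [List.count_append, List.count_cons_self]
      omega
    rw [codeWeight_eq_mul_pow q t (lehmerSum_place hc hmem) (excCount_place hlen),
      count_succ_place, hcount]
    ring
  rw [sum_partialWords_succ_right a hc, sum_congr rfl hmap, sum_congr rfl hplace,
    sum_markedWords (G := fun w => codeWeight q t w * F (w.count c - 1)), ← sum_add_distrib]
  refine sum_congr rfl fun f _ => ?_
  rw [colStep]
  ring

theorem sum_codeWeight_succ_left (q t : R) (a : ℕ) (F : ℕ → R) :
    ∑ f ∈ partialWords (a + 1) (a + 2), codeWeight q t f * F (f.count (a + 2)) =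
      ∑ f ∈ partialWords a (a + 2), codeWeight q t f * rowStep q t F (f.count (a + 2)) := by
  rw [sum_partialWords_succ_left]
  refine sum_congr rfl fun l hl => ?_
  have hlen : l.length = a := ((mem_partialWords (by omega)).1 hl).1
  have hle := excCount_le_lehmerSum l
  have hcard : #{v ∈ Ico 1 (a + 2) | v ∉ l} = l.count (a + 2) + 1 := by
    have := card_filter_notMem_add_length (by omega) hl
    omega
  have hopen : codeWeight q t ((a + 2) :: l) = codeWeight q t l * (t * q ^ l.count (a + 2)) := by
    have hsub : l.count (a + 2) + 1 + lehmerSum l - (1 + excCount l) =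
        lehmerSum l - excCount l + l.count (a + 2) := by omega
    rw [codeWeight, lehmerSum, excCount, hcard, hlen, if_pos (by omega), hsub, codeWeight]
    ring
  have hfill : ∀ v ∈ {v ∈ Ico 1 (a + 2) | v ∉ l},
      codeWeight q t (v :: l) * F ((v :: l).count (a + 2)) =
        codeWeight q t l * F (l.count (a + 2)) *
          q ^ #{e ∈ {v ∈ Ico 1 (a + 2) | v ∉ l} | e < v} := fun v hv => by
    have hva : v < a + 2 := (mem_Ico.1 (mem_filter.1 hv).1).2
    have hfilter : {e ∈ {v ∈ Ico 1 (a + 2) | v ∉ l} | e < v} = {e ∈ Ico 1 v | e ∉ l} := by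
      ext e
      simp only [mem_filter, mem_Ico]
      grind
    rw [List.count_cons_of_ne hva.ne, hfilter, codeWeight_eq_mul_pow q t (f := l)
      (add_comm _ _) (by rw [excCount, if_neg (by omega), zero_add])]
    ring
  rw [sum_congr rfl hfill, ← mul_sum, sum_pow_card_filter_lt, hcard, hopen, List.count_cons_self,
    rowStep]
  ring

theorem sum_codeWeight (q t : R) (n : ℕ) (F : ℕ → R) :
    ∑ f ∈ partialWords n (n + 1), codeWeight q t f * F (f.count (n + 1)) =
      (colStep q ∘ rowStep q t)^[n] F 0 := by
  induction n generalizing F with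
  | zero => simp [partialWords, codeWeight, lehmerSum, excCount]
  | succ n ih =>
    rw [sum_codeWeight_succ_left, sum_codeWeight_succ_right q t n.lt_succ_self, ih,
      Function.iterate_succ_apply, Function.comp_apply]

end CodeWeight

section Word

variable {n : ℕ} (σ : Equiv.Perm (Fin n))

theorem word_succ {i : ℕ} (h : i < n) : word σ (i + 1) = (σ ⟨i, h⟩ : ℕ) + 1 :=
  dif_pos ⟨i.succ_pos, h⟩

theorem word_mem_Icc {i : ℕ} (h : i ∈ Icc 1 n) : word σ i ∈ Icc 1 n := by
  obtain ⟨hi, hin⟩ := mem_Icc.1 h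
  obtain ⟨i, rfl⟩ := Nat.exists_eq_add_of_le' hi
  rw [word_succ σ hin, mem_Icc]
  omega

theorem word_injOn : Set.InjOn (word σ) (Icc 1 n) := by
  intro i hi j hj h
  obtain ⟨hi, hin⟩ := mem_Icc.1 hi
  obtain ⟨hj, hjn⟩ := mem_Icc.1 hj
  obtain ⟨i, rfl⟩ := Nat.exists_eq_add_of_le' hi
  obtain ⟨j, rfl⟩ := Nat.exists_eq_add_of_le' hj
  rw [word_succ σ hin, word_succ σ hjn] at h
  simpa using σ.injective (Fin.ext (Nat.succ_injective h))

theorem image_word : (Icc 1 n).image (word σ) = Icc 1 n :=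
  eq_of_subset_of_card_le (image_subset_iff.2 fun _ => word_mem_Icc σ)
    (card_image_of_injOn (word_injOn σ)).ge

/-- The word `σ(1) ⋯ σ(n)` as a list. -/
def wordList : List ℕ := (List.range' 1 n).map (word σ)

theorem mem_wordList {v : ℕ} : v ∈ wordList σ ↔ v ∈ Icc 1 n := by
  rw [← image_word σ]
  simp only [wordList, List.mem_map, List.mem_range'_1, mem_image, mem_Icc]
  refine exists_congr fun i => and_congr_left fun _ => ?_
  omega

theorem nodup_wordList : (wordList σ).Nodup := by
  refine List.Nodup.map_on (fun i hi j hj h => ?_) List.nodup_range'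
  rw [List.mem_range'_1] at hi hj
  exact word_injOn σ (mem_coe.2 (mem_Icc.2 (by omega))) (mem_coe.2 (mem_Icc.2 (by omega))) h

theorem wordList_perm : (wordList σ).Perm (List.range' 1 n) :=
  (List.perm_ext_iff_of_nodup (nodup_wordList σ) List.nodup_range').2 fun v => by
    rw [mem_wordList, List.mem_range'_1, mem_Icc]
    omega

theorem getElem_wordList {i : ℕ} (h : i < n) :
    (wordList σ)[i]'(by simpa [wordList] using h) = σ ⟨i, h⟩ + 1 := by
  simp [wordList, ← word_succ σ h, add_comm]

theorem wordList_injective : Function.Injective (wordList (n := n)) := by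
  intro σ τ h
  ext i
  simpa [getElem_wordList] using List.getElem_of_eq h (i := i) (by simp [wordList])

theorem exists_wordList_eq {u : List ℕ} (h : u.Perm (List.range' 1 n)) :
    ∃ σ : Equiv.Perm (Fin n), wordList σ = u := by
  have hlen : u.length = n := by simpa using h.length_eq
  have hmem : ∀ i : Fin n, 1 ≤ u[i] ∧ u[i] < 1 + n := fun i =>
    List.mem_range'_1.1 (h.subset (List.getElem_mem _))
  have hinj : Function.Injective fun i : Fin n => (⟨u[i] - 1, by grind⟩ : Fin n) := by
    intro i j hij
    have huij : u[i] = u[j] := by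
      have := hmem i
      have := hmem j
      have := Fin.mk.inj hij
      omega
    exact Fin.ext ((h.nodup_iff.2 List.nodup_range').getElem_inj_iff.1 huij)
  refine ⟨Equiv.ofBijective _ (Finite.injective_iff_bijective.1 hinj), ?_⟩
  refine List.ext_getElem (by simp [wordList, hlen]) fun i _ hi => ?_
  rw [getElem_wordList _ (hlen ▸ hi)]
  exact Nat.sub_add_cancel (hmem ⟨i, hlen ▸ hi⟩).1

theorem sum_wordList {M : Type*} [AddCommMonoid M] {S : Finset (List ℕ)}
    (hS : ∀ u, u ∈ S ↔ u.Perm (List.range' 1 n)) (G : List ℕ → M) :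
    ∑ σ : Equiv.Perm (Fin n), G (wordList σ) = ∑ u ∈ S, G u := by
  have himage : S = univ.image (wordList (n := n)) := by
    ext u
    rw [hS, mem_image]
    exact ⟨fun h => (exists_wordList_eq h).imp fun σ hσ => ⟨mem_univ σ, hσ⟩,
      fun ⟨σ, _, h⟩ => h ▸ wordList_perm σ⟩
  rw [himage, sum_image wordList_injective.injOn]

end Word

section Lehmer

theorem lehmerSum_reverse_map_range' (g : ℕ → ℕ) (n : ℕ) :
    lehmerSum ((List.range' 1 n).map g).reverse =
      ∑ i ∈ Icc 1 n, #{e ∈ Ico 1 (g i) | e ∉ (Ico 1 i).image g} := by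
  induction n with
  | zero => simp [lehmerSum]
  | succ n ih =>
    have hmem : ∀ e, e ∈ ((List.range' 1 n).map g).reverse ↔ e ∈ (Ico 1 (n + 1)).image g := by
      simp [add_comm 1]
    rw [List.range'_1_concat, List.map_append, List.reverse_append, List.map_singleton,
      List.reverse_singleton, List.singleton_append, lehmerSum, ih,
      sum_Icc_succ_top n.succ_pos, add_comm 1 n, add_comm]
    simp only [hmem]

theorem excCount_reverse_map_range' (g : ℕ → ℕ) (n : ℕ) :
    excCount ((List.range' 1 n).map g).reverse = #{i ∈ Icc 1 n | i < g i} := by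
  induction n with
  | zero => simp [excCount]
  | succ n ih =>
    rw [List.range'_1_concat, List.map_append, List.reverse_append, List.map_singleton,
      List.reverse_singleton, List.singleton_append, excCount, ih, card_filter, card_filter,
      sum_Icc_succ_top n.succ_pos, add_comm 1 n, add_comm]
    simp

variable {n : ℕ} (σ : Equiv.Perm (Fin n))

theorem excCount_reverse_wordList : excCount (wordList σ).reverse = exc σ :=
  excCount_reverse_map_range' _ _

theorem lehmerSum_reverse_wordList : lehmerSum (wordList σ).reverse = inv σ := by
  rw [wordList, lehmerSum_reverse_map_range', inv, card_filter, sum_product]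
  refine sum_congr rfl fun i hi => ?_
  have himage : {e ∈ Ico 1 (word σ i) | e ∉ (Ico 1 i).image (word σ)} =
      {j ∈ Icc 1 n | i < j ∧ word σ i > word σ j}.image (word σ) := by
    ext e
    simp only [mem_filter, mem_Ico, mem_image]
    constructor
    · rintro ⟨⟨he, hei⟩, hnot⟩
      have hen : e ∈ Icc 1 n :=
        mem_Icc.2 ⟨he, hei.le.trans (mem_Icc.1 (word_mem_Icc σ hi)).2⟩
      obtain ⟨j, hj, rfl⟩ := mem_image.1 ((image_word σ).symm ▸ hen)
      have hij : i ≤ j := le_of_not_gt fun hji => hnot ⟨j, ⟨(mem_Icc.1 hj).1, hji⟩, rfl⟩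
      exact ⟨j, ⟨hj, hij.lt_of_ne fun h => hei.ne (h ▸ rfl), hei⟩, rfl⟩
    · rintro ⟨j, ⟨hj, hij, hword⟩, rfl⟩
      refine ⟨⟨(mem_Icc.1 (word_mem_Icc σ hj)).1, hword⟩, ?_⟩
      rintro ⟨k, ⟨hk, hki⟩, hkj⟩
      have hkn : k ∈ Icc 1 n := mem_Icc.2 ⟨hk, hki.le.trans (mem_Icc.1 hi).2⟩
      exact (hki.trans hij).ne (word_injOn σ hkn hj hkj)
  rw [himage, card_image_of_injOn ((word_injOn σ).mono (filter_subset _ _)), card_filter]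

variable {R : Type*} [CommSemiring R]

theorem codeWeight_reverse_wordList (q t : R) :
    codeWeight q t (wordList σ).reverse = q ^ (inv σ - exc σ) * t ^ exc σ := by
  rw [codeWeight, lehmerSum_reverse_wordList, excCount_reverse_wordList]

theorem mem_filter_partialWords_iff_perm {u : List ℕ} :
    u ∈ {f ∈ partialWords n (n + 1) | f.count (n + 1) = 0} ↔ u.Perm (List.range' 1 n) := by
  rw [mem_filter, mem_partialWords n.succ_pos, List.count_eq_zero]
  constructor
  · rintro ⟨⟨hlen, hmem, hcount⟩, hlast⟩
    have hmem : ∀ v ∈ u, 1 ≤ v ∧ v < n + 1 := fun v hv =>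
      ⟨(mem_Icc.1 (hmem v hv)).1,
        (mem_Icc.1 (hmem v hv)).2.lt_of_ne (ne_of_mem_of_not_mem hv hlast)⟩
    have hnodup : u.Nodup := List.nodup_iff_count_le_one.2 fun v => by
      by_cases hv : v ∈ u
      · exact hcount v (hmem v hv).2
      · simp [List.count_eq_zero.2 hv]
    refine (List.subperm_of_subset hnodup fun v hv => ?_).perm_of_length_le (by simp [hlen])
    exact List.mem_range'_1.2 (add_comm n 1 ▸ hmem v hv)
  · intro h
    have hnodup : u.Nodup := h.nodup_iff.2 List.nodup_range'
    refine ⟨⟨by simpa using h.length_eq, fun v hv => ?_, fun v _ => ?_⟩, ?_⟩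
    · have := List.mem_range'_1.1 (h.subset hv)
      exact mem_Icc.2 (by omega)
    · exact List.nodup_iff_count_le_one.1 hnodup v
    · simp [h.mem_iff, add_comm]

theorem sum_inv_exc (q t : R) (n : ℕ) :
    ∑ σ : Equiv.Perm (Fin n), q ^ (inv σ - exc σ) * t ^ exc σ =
      (colStep q ∘ rowStep q t)^[n] (Pi.single 0 1) 0 := by
  have hrev : ∀ u ∈ {f ∈ partialWords n (n + 1) | f.count (n + 1) = 0},
      u.reverse ∈ {f ∈ partialWords n (n + 1) | f.count (n + 1) = 0} := fun u hu =>
    mem_filter_partialWords_iff_perm.2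
      (u.reverse_perm.trans (mem_filter_partialWords_iff_perm.1 hu))
  simp only [← codeWeight_reverse_wordList, ← sum_codeWeight, Pi.single_apply, mul_ite, mul_one,
    mul_zero]
  rw [sum_wordList (fun u => mem_filter_partialWords_iff_perm) fun u => codeWeight q t u.reverse,
    ← sum_filter]
  exact sum_nbij' List.reverse List.reverse hrev hrev (fun u _ => u.reverse_reverse)
    (fun u _ => u.reverse_reverse) fun u _ => rfl

end Lehmer

section SlotWords

/-- The letter `c` does not occur twice in a row in the word `u`. -/
def NonAdj (c : ℕ) (u : List ℕ) : Prop := u.IsChain fun a b => ¬(a = c ∧ b = c)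

variable {c : ℕ} {x y : List ℕ} {l r : Bool}

theorem nonAdj_reverse {u : List ℕ} : NonAdj c u.reverse ↔ NonAdj c u := by
  simp only [NonAdj, List.isChain_reverse, and_comm]

theorem nonAdj_append_cons :
    NonAdj c (x ++ c :: y) ↔ NonAdj c (c :: x.reverse) ∧ NonAdj c (c :: y) := by
  rw [← nonAdj_reverse (u := c :: x.reverse), List.reverse_cons, List.reverse_reverse]
  exact List.isChain_split

theorem nonAdj_place : NonAdj (c + 1) (place c x y) ↔ NonAdj c x ∧ NonAdj c y := by
  have hbump : ∀ a, bump c a = c + 1 ↔ a = c := fun a => by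
    rw [← bump_self c, (bump_injective c).eq_iff]
  simp only [NonAdj, place, List.isChain_append, List.isChain_cons, List.isChain_map, hbump]
  simp

theorem NonAdj.replicate_append (h : NonAdj c (c :: y)) (r : Bool) :
    NonAdj c (List.replicate r.toNat c ++ y) := by
  cases r
  · exact h.tail
  · exact h

theorem NonAdj.exists_replicate_append {z : List ℕ} (h : NonAdj c z) :
    ∃ (r : Bool) (y : List ℕ), List.replicate r.toNat c ++ y = z ∧ NonAdj c (c :: y) := by
  obtain _ | ⟨a, z⟩ := z
  · exact ⟨false, [], rfl, List.isChain_singleton c⟩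
  by_cases ha : a = c
  · exact ⟨true, z, ha ▸ rfl, ha ▸ h⟩
  · exact ⟨false, a :: z, rfl, List.isChain_cons_cons.2 ⟨fun hca => ha hca.2, h⟩⟩

theorem replicate_append_inj {y y' : List ℕ} {r r' : Bool} (h : NonAdj c (c :: y))
    (h' : NonAdj c (c :: y')) :
    List.replicate r.toNat c ++ y = List.replicate r'.toNat c ++ y' ↔ r = r' ∧ y = y' := by
  have hcons : ∀ {z}, ¬NonAdj c (c :: c :: z) := fun hz =>
    (List.isChain_cons_cons.1 hz).1 ⟨rfl, rfl⟩
  cases r <;> cases r'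
  · simp
  · suffices y ≠ c :: y' by simpa
    rintro rfl
    exact hcons h
  · suffices c :: y ≠ y' by simpa
    rintro rfl
    exact hcons h'
  · simp

/-- A slot word: a permutation of `1, …, c - 1` in which some of the gaps are filled by the letter
`c`, which stands for a nonempty block of larger letters that are still to be inserted. -/
structure IsSlotWord (c : ℕ) (u : List ℕ) : Prop where
  ne_nil : u ≠ []
  mem_Icc : ∀ v ∈ u, v ∈ Icc 1 c
  count_eq_one : ∀ v ∈ Ico 1 c, u.count v = 1
  nonAdj : NonAdj c u

/-- The word obtained from `x ++ c :: y` by inserting the value `c` into the marked slot; `l` and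
`r` tell whether a slot remains to its left and to its right. -/
def fillSlot (c : ℕ) (x y : List ℕ) (l r : Bool) : List ℕ :=
  place c (x ++ List.replicate l.toNat c) (List.replicate r.toNat c ++ y)

theorem fillSlot_inj {x' y' : List ℕ} {l' r' : Bool} (h : NonAdj c (x ++ c :: y))
    (h' : NonAdj c (x' ++ c :: y')) :
    fillSlot c x y l r = fillSlot c x' y' l' r' ↔ (x = x' ∧ y = y') ∧ l = l' ∧ r = r' := by
  rw [nonAdj_append_cons] at h h'
  have hleft := replicate_append_inj (r := l) (r' := l') h.1 h'.1
  rw [← List.reverse_inj] at hleft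
  simp only [List.reverse_append, List.reverse_reverse, List.reverse_replicate,
    List.reverse_inj] at hleft
  rw [fillSlot, fillSlot, place_inj, hleft, replicate_append_inj h.2 h'.2]
  tauto

theorem reverse_fillSlot (c : ℕ) (x y : List ℕ) (l r : Bool) :
    (fillSlot c x y l r).reverse = fillSlot c y.reverse x.reverse r l := by
  simp [fillSlot, reverse_place]

theorem count_succ_fillSlot (c : ℕ) (x y : List ℕ) (l r : Bool) :
    (fillSlot c x y l r).count (c + 1) = x.count c + y.count c + l.toNat + r.toNat := by
  simp only [fillSlot, count_succ_place, List.count_append, List.count_replicate_self]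
  omega

theorem count_fillSlot_of_lt {v : ℕ} (h : v < c) (x y : List ℕ) (l r : Bool) :
    (fillSlot c x y l r).count v = (x ++ c :: y).count v := by
  simp [fillSlot, count_place_of_lt h, List.count_replicate, h.ne']

theorem isSlotWord_fillSlot (hc : 0 < c) (hxy : NonAdj c (x ++ c :: y)) :
    IsSlotWord (c + 1) (fillSlot c x y l r) ↔ IsSlotWord c (x ++ c :: y) := by
  have hmem : (∀ v ∈ fillSlot c x y l r, v ∈ Icc 1 (c + 1)) ↔
      ∀ v ∈ x ++ c :: y, v ∈ Icc 1 c := by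
    rw [fillSlot, forall_mem_place hc]
    simp only [List.mem_append, List.mem_cons, List.mem_replicate]
    grind
  have hcount : (∀ v ∈ Ico 1 (c + 1), (fillSlot c x y l r).count v = 1) ↔
      ∀ v ∈ Ico 1 c, (x ++ c :: y).count v = 1 := by
    rw [← insert_Ico_right_eq_Ico_add_one hc, forall_mem_insert, fillSlot, count_place_self,
      ← fillSlot, eq_self, true_and]
    exact forall₂_congr fun v hv => by rw [count_fillSlot_of_lt (mem_Ico.1 hv).2]
  have hnonAdj : NonAdj (c + 1) (fillSlot c x y l r) := by
    obtain ⟨hx, hy⟩ := nonAdj_append_cons.1 hxy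
    refine nonAdj_place.2 ⟨?_, hy.replicate_append r⟩
    simpa [← nonAdj_reverse (u := x ++ _)] using hx.replicate_append l
  constructor
  · exact fun h => ⟨by simp, hmem.1 h.mem_Icc, hcount.1 h.count_eq_one, hxy⟩
  · exact fun h => ⟨by simp [fillSlot, place], hmem.2 h.mem_Icc, hcount.2 h.count_eq_one, hnonAdj⟩

theorem IsSlotWord.exists_fillSlot {u : List ℕ} (hc : 0 < c) (h : IsSlotWord (c + 1) u) :
    ∃ x y l r, NonAdj c (x ++ c :: y) ∧ fillSlot c x y l r = u := by
  obtain ⟨x', y', rfl⟩ :=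
    exists_place_eq (h.count_eq_one c (mem_Ico.2 ⟨hc, c.lt_succ_self⟩))
  obtain ⟨hx', hy'⟩ := nonAdj_place.1 h.nonAdj
  obtain ⟨l, x, hx, hcx⟩ := (nonAdj_reverse.2 hx').exists_replicate_append
  obtain ⟨r, y, rfl, hcy⟩ := hy'.exists_replicate_append
  refine ⟨x.reverse, y, l, r, nonAdj_append_cons.2 ⟨by rwa [List.reverse_reverse], hcy⟩, ?_⟩
  rw [fillSlot, ← List.reverse_reverse x', ← hx]
  simp

theorem isSlotWord_one {u : List ℕ} : IsSlotWord 1 u ↔ u = [1] := by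
  constructor
  · rintro ⟨hne, hmem, -, hnonAdj⟩
    have hone : ∀ v ∈ u, v = 1 := fun v hv => by simpa using hmem v hv
    obtain _ | ⟨a, _ | ⟨b, u⟩⟩ := u
    · exact absurd rfl hne
    · simpa using hone
    · exact absurd ⟨hone a (by simp), hone b (by simp)⟩ (List.isChain_cons_cons.1 hnonAdj).1
  · rintro rfl
    exact ⟨by simp, by simp, by simp, List.isChain_singleton 1⟩

/-- The slot words with values `1, …, m`; the letter `m + 1` marks the slots. -/
def slotWords : ℕ → Finset (List ℕ)
  | 0 => {[1]}
  | m + 1 => (markedWords (m + 1) (slotWords m) ×ˢ (univ : Finset (Bool × Bool))).image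
      fun z => fillSlot (m + 1) z.1.1 z.1.2 z.2.1 z.2.2

theorem mem_slotWords {m : ℕ} {u : List ℕ} : u ∈ slotWords m ↔ IsSlotWord (m + 1) u := by
  induction m generalizing u with
  | zero => rw [slotWords, mem_singleton, isSlotWord_one]
  | succ m ih =>
    simp only [slotWords, mem_image, mem_product, mem_markedWords, ih, mem_univ, and_true]
    constructor
    · rintro ⟨z, hz, rfl⟩
      exact (isSlotWord_fillSlot m.succ_pos hz.nonAdj).2 hz
    · intro h
      obtain ⟨x, y, l, r, hxy, rfl⟩ := h.exists_fillSlot m.succ_pos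
      exact ⟨((x, y), l, r), (isSlotWord_fillSlot m.succ_pos hxy).1 h, rfl⟩

theorem sum_slotWords_succ {M : Type*} [AddCommMonoid M] (m : ℕ) (G : List ℕ → M) :
    ∑ u ∈ slotWords (m + 1), G u =
      ∑ z ∈ markedWords (m + 1) (slotWords m), ∑ s : Bool × Bool,
        G (fillSlot (m + 1) z.1 z.2 s.1 s.2) := by
  rw [slotWords, sum_image, sum_product]
  rintro ⟨⟨x, y⟩, l, r⟩ hz ⟨⟨x', y'⟩, l', r'⟩ hz' h
  simp only [coe_product, Set.mem_prod, mem_coe, mem_markedWords, mem_slotWords] at hz hz'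
  simpa using (fillSlot_inj hz.1.nonAdj hz'.1.nonAdj).1 h

end SlotWords

section Profile

/-- The view from a letter `v` towards one side, where `s` is the list of letters met: is the
adjacent letter larger than `v`, and how often is a letter at most `v` followed by a larger one? -/
def sideProfile (v : ℕ) : List ℕ → Bool × ℕ
  | [] => (false, 0)
  | a :: s =>
    if v < a then (true, (sideProfile v s).2)
    else (false, (sideProfile v s).2 + (sideProfile v s).1.toNat)

/-- The views from the first occurrence of the letter `v` in `u` to the left and to the right. For
a permutation, the numbers in it count the patterns `31-2` and `2-13` in which `v` is the `2`. -/
def profile (v : ℕ) (u : List ℕ) : (Bool × ℕ) × (Bool × ℕ) :=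
  (sideProfile v (u.takeWhile (· ≠ v)).reverse, sideProfile v (u.dropWhile (· ≠ v)).tail)

variable {c v : ℕ} {x y : List ℕ} {l r : Bool}

theorem profile_append_cons (h : v ∉ x) (y : List ℕ) :
    profile v (x ++ v :: y) = (sideProfile v x.reverse, sideProfile v y) := by
  have hx : ∀ a ∈ x, decide (a ≠ v) = true := fun a ha =>
    decide_eq_true (ne_of_mem_of_not_mem ha h)
  rw [profile, List.takeWhile_append_of_pos hx, List.dropWhile_append_of_pos hx]
  simp

theorem sideProfile_map_bump (h : v < c) (s : List ℕ) :
    sideProfile v (s.map (bump c)) = sideProfile v s := by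
  induction s with
  | nil => rfl
  | cons a s ih => simp only [List.map_cons, sideProfile, lt_bump_iff h, ih]

theorem sideProfile_append_congr {s s' : List ℕ} (h : sideProfile v s = sideProfile v s') :
    sideProfile v (x ++ s) = sideProfile v (x ++ s') := by
  induction x with
  | nil => exact h
  | cons a x ih => simp only [List.cons_append, sideProfile, ih]

theorem sideProfile_fillSlot (h : v < c) (x y : List ℕ) (l r : Bool) :
    sideProfile v (fillSlot c x y l r) = sideProfile v (x ++ c :: y) := by
  have hplace : ∀ x y, sideProfile v (place c x y) = sideProfile v (x ++ c :: y) := fun x y => by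
    rw [← sideProfile_map_bump h (x ++ c :: y), List.map_append, place]
    refine sideProfile_append_congr ?_
    simp only [List.map_cons, sideProfile, lt_bump_iff h]
  rw [fillSlot, hplace, List.append_assoc]
  refine sideProfile_append_congr ?_
  cases l <;> cases r <;> simp [sideProfile, h]

theorem profile_fillSlot_of_lt (h : v < c) (hv : v ∈ x ++ c :: y) :
    profile v (fillSlot c x y l r) = profile v (x ++ c :: y) := by
  by_cases hx : v ∈ x
  · obtain ⟨p, s, rfl, hp⟩ := List.eq_append_cons_of_mem hx
    have hsplit : fillSlot c (p ++ v :: s) y l r = p.map (bump c) ++ v :: fillSlot c s y l r := by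
      simp [fillSlot, place, bump_of_lt h]
    rw [hsplit, profile_append_cons (by rwa [mem_map_bump_of_lt h]), ← List.map_reverse,
      sideProfile_map_bump h, sideProfile_fillSlot h, List.append_assoc, List.cons_append,
      profile_append_cons hp]
  · have hvy : v ∈ y := by simpa [hx, h.ne] using hv
    obtain ⟨p, s, rfl, hp⟩ := List.eq_append_cons_of_mem hvy
    have hsplit : fillSlot c x (p ++ v :: s) l r = fillSlot c x p l r ++ v :: s.map (bump c) := by
      simp [fillSlot, place, bump_of_lt h]
    have hxp : v ∉ x ++ c :: p := by simp [hx, hp, h.ne]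
    have hfill : v ∉ fillSlot c x p l r := by
      rwa [← List.count_eq_zero, count_fillSlot_of_lt h, List.count_eq_zero]
    rw [hsplit, profile_append_cons hfill, sideProfile_map_bump h, reverse_fillSlot,
      sideProfile_fillSlot h, ← List.cons_append, ← List.append_assoc, profile_append_cons hxp]
    simp

theorem sideProfile_map_bump_fst (hy : ∀ a ∈ y, a ≤ c) (h : NonAdj c (c :: y)) :
    (sideProfile c (y.map (bump c))).1 = false := by
  obtain _ | ⟨a, y⟩ := y
  · rfl
  have ha : a < c := (hy a List.mem_cons_self).lt_of_ne fun hac =>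
    (List.isChain_cons_cons.1 h).1 ⟨rfl, hac⟩
  simp [sideProfile, bump_of_lt ha, ha.not_gt]

theorem sideProfile_map_bump_snd_add_fst (hy : ∀ a ∈ y, a ≤ c) (h : NonAdj c y) :
    (sideProfile c (y.map (bump c))).2 + (sideProfile c (y.map (bump c))).1.toNat =
      y.count c := by
  induction y with
  | nil => rfl
  | cons a y ih =>
    obtain ⟨ha, hy⟩ := List.forall_mem_cons.1 hy
    have ih := ih hy h.tail
    rcases ha.lt_or_eq with ha | rfl
    · simpa [sideProfile, bump_of_lt ha, ha.not_gt, ha.ne] using ih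
    · simpa [sideProfile, bump_self, sideProfile_map_bump_fst hy h] using ih

theorem sideProfile_replicate_append (hy : ∀ a ∈ y, a ≤ c) (h : NonAdj c (c :: y)) (r : Bool) :
    sideProfile c ((List.replicate r.toNat c ++ y).map (bump c)) = (r, y.count c) := by
  have hfst := sideProfile_map_bump_fst hy h
  have hsnd := sideProfile_map_bump_snd_add_fst hy h.tail
  rw [hfst, Bool.toNat_false, add_zero] at hsnd
  cases r
  · exact Prod.ext hfst hsnd
  · simp [sideProfile, bump_self, hsnd]

theorem profile_fillSlot_self (hxy : IsSlotWord c (x ++ c :: y)) :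
    profile c (fillSlot c x y l r) = ((l, x.count c), (r, y.count c)) := by
  have hle : ∀ a ∈ x ++ c :: y, a ≤ c := fun a ha => (mem_Icc.1 (hxy.mem_Icc a ha)).2
  obtain ⟨hx, hy⟩ := nonAdj_append_cons.1 hxy.nonAdj
  have hleft := sideProfile_replicate_append (fun a ha => hle a (by simp_all)) hx l
  have hright := sideProfile_replicate_append (fun a ha => hle a (by simp_all)) hy r
  rw [List.count_reverse] at hleft
  rw [fillSlot, place, profile_append_cons (notMem_map_bump c _), hright, ← List.map_reverse,
    List.reverse_append, List.reverse_replicate, hleft]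

end Profile

section WordWeight

variable {R : Type*} [CommSemiring R]

/-- The weight of a letter: the factor `w` depends on whether the letters to the left and to the
right are larger; `p` and `r` record the pattern numbers of the two sides. -/
def letterWeight (p r : R) (w : Bool → Bool → R) (z : (Bool × ℕ) × (Bool × ℕ)) : R :=
  w z.1.1 z.2.1 * (p ^ z.1.2 * r ^ z.2.2)

/-- The product of the weights of the letters `1, …, m`. -/
def wordWeight (p r : R) (w : Bool → Bool → R) (m : ℕ) (u : List ℕ) : R :=
  ∏ v ∈ Icc 1 m, letterWeight p r w (profile v u)

/-- The effect on `∑ u, wordWeight p r w m u * F k`, where `k` is the number of slots of `u`, of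
inserting the value `m + 1`. -/
def slotStep (p r : R) (w : Bool → Bool → R) (F : ℕ → R) (k : ℕ) : R :=
  qInt p r k * (w false false * F (k - 1) + (w true false + w false true) * F k +
    w true true * F (k + 1))

variable (p r : R) (w : Bool → Bool → R)

theorem wordWeight_fillSlot {m : ℕ} {x y : List ℕ} (h : IsSlotWord (m + 1) (x ++ (m + 1) :: y))
    (s : Bool × Bool) :
    wordWeight p r w (m + 1) (fillSlot (m + 1) x y s.1 s.2) =
      wordWeight p r w m (x ++ (m + 1) :: y) *
        (w s.1 s.2 * (p ^ x.count (m + 1) * r ^ y.count (m + 1))) := by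
  rw [wordWeight, prod_Icc_succ_top m.succ_pos, profile_fillSlot_self h, wordWeight]
  congr 1
  refine prod_congr rfl fun v hv => ?_
  have hvm : v < m + 1 := Nat.lt_succ_of_le (mem_Icc.1 hv).2
  have hcount := h.count_eq_one v (mem_Ico.2 ⟨(mem_Icc.1 hv).1, hvm⟩)
  rw [profile_fillSlot_of_lt hvm (List.count_pos_iff.1 (hcount.ge))]

theorem sum_wordWeight_succ (m : ℕ) (F : ℕ → R) :
    ∑ u ∈ slotWords (m + 1), wordWeight p r w (m + 1) u * F (u.count (m + 2)) =
      ∑ u ∈ slotWords m, wordWeight p r w m u * slotStep p r w F (u.count (m + 1)) := by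
  let F' : ℕ → R := fun k =>
    w false false * F (k - 1) + (w true false + w false true) * F k + w true true * F (k + 1)
  have hstep : ∀ z ∈ markedWords (m + 1) (slotWords m),
      ∑ s : Bool × Bool, wordWeight p r w (m + 1) (fillSlot (m + 1) z.1 z.2 s.1 s.2) *
          F ((fillSlot (m + 1) z.1 z.2 s.1 s.2).count (m + 2)) =
        wordWeight p r w m (z.1 ++ (m + 1) :: z.2) * F' ((z.1 ++ (m + 1) :: z.2).count (m + 1)) *
          (p ^ z.1.count (m + 1) * r ^ z.2.count (m + 1)) := fun z hz => by
    have hz := mem_slotWords.1 (mem_markedWords.1 hz)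
    simp only [F', wordWeight_fillSlot p r w hz, count_succ_fillSlot, Fintype.sum_prod_type,
      Fintype.sum_bool, List.count_append, List.count_cons_self, Bool.toNat_true,
      Bool.toNat_false, add_zero, ← add_assoc, Nat.add_sub_cancel]
    ring
  rw [sum_slotWords_succ, sum_congr rfl hstep,
    sum_markedWords (G := fun u => wordWeight p r w m u * F' (u.count (m + 1)))]
  refine sum_congr rfl fun u _ => ?_
  rw [slotStep]
  ring

theorem sum_wordWeight (n : ℕ) (F : ℕ → R) :
    ∑ u ∈ slotWords n, wordWeight p r w n u * F (u.count (n + 1)) = (slotStep p r w)^[n] F 1 := by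
  induction n generalizing F with
  | zero => simp [slotWords, wordWeight]
  | succ n ih => rw [sum_wordWeight_succ, ih, Function.iterate_succ_apply]

end WordWeight

section PermProfile

theorem sideProfile_map_range' {v m : ℕ} {g : ℕ → ℕ} (a : ℕ) (h : g (a + m) ≤ v) :
    sideProfile v ((List.range' a m).map g) =
      (decide (v < g a), #{i ∈ Ioc a (a + m) | g (i - 1) ≤ v ∧ v < g i}) := by
  induction m generalizing a with
  | zero => simpa [sideProfile] using h
  | succ m ih =>
    have hm : a + (m + 1) = a + 1 + m := by omega
    have hIoc := insert_Ioc_add_one_left_eq_Ioc (show a < a + 1 + m by omega)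
    rw [hm] at h
    rw [List.range'_succ, List.map_cons, sideProfile, ih (a + 1) h, hm, ← hIoc, filter_insert]
    rw [Bool.toNat, Bool.cond_decide]
    split_ifs <;> grind

theorem sideProfile_reverse_map_range' {v : ℕ} {g : ℕ → ℕ} (h : g 0 ≤ v) (m : ℕ) :
    sideProfile v ((List.range' 1 m).map g).reverse =
      (decide (v < g m), #{i ∈ Icc 1 m | g i ≤ v ∧ v < g (i - 1)}) := by
  induction m with
  | zero => simp [sideProfile, h.not_gt]
  | succ m ih =>
    rw [List.range'_1_concat, List.map_append, List.reverse_append, List.map_singleton,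
      List.reverse_singleton, List.singleton_append, sideProfile, ih, add_comm 1 m,
      ← insert_Icc_right_eq_Icc_add_one (by omega), filter_insert]
    rw [Bool.toNat, Bool.cond_decide]
    split_ifs <;> grind

variable {n : ℕ} (σ : Equiv.Perm (Fin n))

theorem word_eq_zero {i : ℕ} (h : i ∉ Icc 1 n) : word σ i = 0 :=
  dif_neg fun hi => h (mem_Icc.2 hi)

theorem wordList_eq_append {j : ℕ} (hj : j ∈ Icc 1 n) :
    wordList σ = (List.range' 1 (j - 1)).map (word σ) ++
      word σ j :: (List.range' (j + 1) (n - j)).map (word σ) := by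
  obtain ⟨hj, hjn⟩ := mem_Icc.1 hj
  rw [wordList, ← List.map_cons, ← List.map_append, ← List.range'_succ]
  congr 1
  have := List.range'_append (s := 1) (m := j - 1) (n := n - j + 1) (step := 1)
  rw [show 1 + 1 * (j - 1) = j by omega, show j - 1 + (n - j + 1) = n by omega] at this
  exact this.symm

/-- Is the letter in place `j` smaller than its left neighbour, and than its right neighbour? -/
def shape (j : ℕ) : Bool × Bool :=
  (decide (word σ j < word σ (j - 1)), decide (word σ j < word σ (j + 1)))

theorem word_ne_word {i j : ℕ} (hj : j ∈ Icc 1 n) (h : i ≠ j) : word σ i ≠ word σ j := by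
  by_cases hi : i ∈ Icc 1 n
  · exact fun hw => h (word_injOn σ hi hj hw)
  · have := mem_Icc.1 (word_mem_Icc σ hj)
    rw [word_eq_zero σ hi]
    omega

theorem profile_wordList {j : ℕ} (hj : j ∈ Icc 1 n) :
    profile (word σ j) (wordList σ) =
      (((shape σ j).1,
        #{i ∈ Icc 2 n | i < j ∧ word σ (i - 1) > word σ j ∧ word σ j > word σ i}),
      ((shape σ j).2,
        #{i ∈ Icc 1 n | j < i ∧ word σ i > word σ j ∧ word σ j > word σ (i - 1)})) := by
  obtain ⟨hj1, hjn⟩ := mem_Icc.1 hj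
  have h0 : word σ 0 = 0 := word_eq_zero σ (by simp)
  have hlast : word σ (n + 1) = 0 := word_eq_zero σ (by simp)
  have hend : word σ (j + 1 + (n - j)) = 0 := by rwa [show j + 1 + (n - j) = n + 1 by omega]
  have hnot : word σ j ∉ (List.range' 1 (j - 1)).map (word σ) := by
    rintro h
    obtain ⟨i, hi, hij⟩ := List.mem_map.1 h
    rw [List.mem_range'_1] at hi
    exact word_ne_word σ hj (by omega) hij
  rw [wordList_eq_append σ hj, profile_append_cons hnot,
    sideProfile_reverse_map_range' (h0.trans_le (Nat.zero_le _)),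
    sideProfile_map_range' _ (hend.trans_le (Nat.zero_le _)), shape]
  congr 3
  · ext i
    have := word_ne_word σ hj (i := i)
    have : i = 1 → word σ (i - 1) = 0 := by rintro rfl; exact h0
    simp only [mem_filter, mem_Icc]
    omega
  · ext i
    have := word_ne_word σ hj (i := i - 1)
    have : i = n + 1 → word σ i = 0 := by rintro rfl; exact hlast
    have : i = j + 1 → word σ (i - 1) = word σ j := by rintro rfl; rfl
    simp only [mem_filter, mem_Icc, mem_Ioc]
    omega

theorem pat31_2_eq_sum : pat31_2 σ = ∑ j ∈ Icc 1 n,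
    #{i ∈ Icc 2 n | i < j ∧ word σ (i - 1) > word σ j ∧ word σ j > word σ i} := by
  rw [pat31_2, card_filter, sum_product_right]
  simp only [← card_filter]
  refine sum_subset (Icc_subset_Icc_left one_le_two) fun j hj hj' => ?_
  rw [card_eq_zero, filter_eq_empty_iff]
  intro i hi h
  simp only [mem_Icc] at hi hj hj'
  omega

theorem pat2_13_eq_sum : pat2_13 σ = ∑ j ∈ Icc 1 n,
    #{i ∈ Icc 1 n | j < i ∧ word σ i > word σ j ∧ word σ j > word σ (i - 1)} := by
  rw [pat2_13, card_filter, sum_product]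
  simp only [← card_filter]

variable {R : Type*} [CommSemiring R]

theorem wordWeight_wordList (p r : R) (w : Bool → Bool → R) :
    wordWeight p r w n (wordList σ) =
      (∏ j ∈ Icc 1 n, w (shape σ j).1 (shape σ j).2) * (p ^ pat31_2 σ * r ^ pat2_13 σ) := by
  rw [pat31_2_eq_sum, pat2_13_eq_sum, ← prod_pow_eq_pow_sum, ← prod_pow_eq_pow_sum,
    ← prod_mul_distrib, ← prod_mul_distrib]
  nth_rw 1 [wordWeight, ← image_word σ]
  rw [prod_image (word_injOn σ)]
  exact prod_congr rfl fun j hj => by rw [profile_wordList σ hj, letterWeight]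

theorem mem_filter_slotWords_iff_perm {u : List ℕ} (hn : 1 ≤ n) :
    u ∈ {u ∈ slotWords n | u.count (n + 1) = 0} ↔ u.Perm (List.range' 1 n) := by
  rw [mem_filter, mem_slotWords]
  constructor
  · rintro ⟨hu, hlast⟩
    refine List.perm_iff_count.2 fun v => ?_
    rw [List.count_range_1']
    split_ifs with hv
    · exact hu.count_eq_one v (mem_Ico.2 ⟨hv.1, by omega⟩)
    · refine List.count_eq_zero.2 fun hvu => ?_
      have := mem_Icc.1 (hu.mem_Icc v hvu)
      obtain rfl : v = n + 1 := by omega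
      exact List.count_eq_zero.1 hlast hvu
  · intro h
    have hlast : u.count (n + 1) = 0 := by simp [h.count_eq, add_comm]
    refine ⟨⟨?_, fun v hv => ?_, fun v hv => ?_, ?_⟩, hlast⟩
    · rintro rfl
      rw [List.nil_perm, List.range'_eq_nil_iff] at h
      omega
    · have := List.mem_range'_1.1 (h.subset hv)
      exact mem_Icc.2 (by omega)
    · rw [h.count_eq, List.count_range_1', if_pos]
      have := mem_Ico.1 hv
      omega
    · refine List.Pairwise.isChain (List.pairwise_of_forall_mem_list fun a ha b _ hab => ?_)
      exact List.count_eq_zero.1 hlast (hab.1 ▸ ha)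

theorem sum_prod_shape (p r : R) (w : Bool → Bool → R) (hn : 1 ≤ n) :
    ∑ σ : Equiv.Perm (Fin n),
        (∏ j ∈ Icc 1 n, w (shape σ j).1 (shape σ j).2) * (p ^ pat31_2 σ * r ^ pat2_13 σ) =
      (slotStep p r w)^[n] (Pi.single 0 1) 1 := by
  simp only [← wordWeight_wordList, ← sum_wordWeight, Pi.single_apply, mul_ite, mul_one, mul_zero]
  rw [sum_wordList (fun u => mem_filter_slotWords_iff_perm hn) (wordWeight p r w n), ← sum_filter]

end PermProfile

section Shape

variable {n : ℕ} (σ : Equiv.Perm (Fin n))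

/-- The number of letters of the given shape. -/
def shapeCount (s : Bool × Bool) : ℕ :=
  #{j ∈ Icc 1 n | shape σ j = s}

theorem shapeCount_true_false : shapeCount σ (true, false) = dd σ := by
  rw [shapeCount, dd]
  congr 1
  refine filter_congr fun j hj => ?_
  have := word_ne_word σ hj (i := j + 1)
  simp only [shape, Prod.mk.injEq, decide_eq_true_eq, decide_eq_false_iff_not]
  omega

theorem sum_shapeCount : ∑ s, shapeCount σ s = n := by
  have h := card_eq_sum_card_fiberwise (f := shape σ) (s := Icc 1 n) (t := univ) fun _ _ =>
    mem_coe.2 (mem_univ _)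
  rw [Nat.card_Icc, Nat.add_sub_cancel] at h
  exact h.symm

theorem card_word_lt_left : #{j ∈ Icc 1 n | word σ j < word σ (j - 1)} = des σ := by
  refine card_nbij' (· - 1) (· + 1) (fun j hj => ?_) (fun j hj => ?_) (fun j hj => ?_)
    fun j _ => Nat.add_sub_cancel j 1
  all_goals simp only [coe_filter, mem_Icc, Set.mem_ofPred_eq] at hj ⊢
  · have : j ≠ 1 := by
      rintro rfl
      simp [word_eq_zero] at hj
    rw [Nat.sub_add_cancel hj.1.1]
    omega
  · rw [Nat.add_sub_cancel]
    omega
  · omega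

theorem card_not_word_lt_right (hn : 1 ≤ n) :
    #{j ∈ Icc 1 n | ¬word σ j < word σ (j + 1)} = des σ + 1 := by
  have hlast : word σ (n + 1) = 0 := word_eq_zero σ (by simp)
  have hins : {j ∈ Icc 1 n | ¬word σ j < word σ (j + 1)} =
      insert n {j ∈ Icc 1 (n - 1) | word σ j > word σ (j + 1)} := by
    ext j
    have hne : j ∈ Icc 1 n → word σ (j + 1) ≠ word σ j := fun hj => word_ne_word σ hj j.succ_ne_self
    rcases eq_or_ne j n with rfl | hj
    · simp [hlast, hn]
    · simp only [mem_filter, mem_insert, mem_Icc] at hne ⊢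
      omega
  rw [hins, card_insert_of_notMem fun h => ?_, des]
  have := mem_Icc.1 (mem_filter.1 h).1
  omega

theorem shapeCount_true_true_add_dd : shapeCount σ (true, true) + dd σ = des σ := by
  rw [← shapeCount_true_false, ← card_word_lt_left, shapeCount, shapeCount,
    card_filter, card_filter, card_filter, ← sum_add_distrib]
  refine sum_congr rfl fun j _ => ?_
  by_cases word σ j < word σ (j + 1) <;> simp_all [shape]

theorem shapeCount_false_false_add_dd (hn : 1 ≤ n) :
    shapeCount σ (false, false) + dd σ = des σ + 1 := by
  rw [← shapeCount_true_false, ← card_not_word_lt_right σ hn, shapeCount, shapeCount,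
    card_filter, card_filter, card_filter, ← sum_add_distrib]
  refine sum_congr rfl fun j _ => ?_
  by_cases word σ j < word σ (j - 1) <;> simp_all [shape]

theorem two_mul_des_add (hn : 1 ≤ n) (h : dd σ = 0) :
    2 * des σ + 1 + shapeCount σ (false, true) = n := by
  have hvalley := shapeCount_true_true_add_dd σ
  have hpeak := shapeCount_false_false_add_dd σ hn
  have hsum := sum_shapeCount σ
  simp only [Fintype.sum_prod_type, Fintype.sum_bool, shapeCount_true_false] at hsum
  omega

variable {R : Type*} [CommSemiring R]

/-- The letter weight that forbids double descents and gives `X` to valleys (both neighbours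
larger), `Y` to double ascents and `1` to peaks. -/
def noDDWeight (X Y : R) : Bool → Bool → R
  | true, true => X
  | true, false => 0
  | false, true => Y
  | false, false => 1

theorem prod_noDDWeight (X Y : R) (hn : 1 ≤ n) :
    ∏ j ∈ Icc 1 n, noDDWeight X Y (shape σ j).1 (shape σ j).2 =
      if dd σ = 0 then X ^ des σ * Y ^ (n - 1 - 2 * des σ) else 0 := by
  have hprod : ∏ j ∈ Icc 1 n, noDDWeight X Y (shape σ j).1 (shape σ j).2 =
      ∏ s : Bool × Bool, noDDWeight X Y s.1 s.2 ^ shapeCount σ s := by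
    simp only [shapeCount, ← prod_const]
    exact (prod_fiberwise' (Icc 1 n) (shape σ) fun s => noDDWeight X Y s.1 s.2).symm
  rw [hprod]
  simp only [Fintype.prod_prod_type, Fintype.prod_bool, noDDWeight, one_pow, mul_one,
    shapeCount_true_false]
  split_ifs with h
  · have hvalley := shapeCount_true_true_add_dd σ
    have htotal := two_mul_des_add σ hn h
    rw [h, add_zero] at hvalley
    rw [h, pow_zero, mul_one, hvalley, show shapeCount σ (false, true) = n - 1 - 2 * des σ by omega]
  · rw [zero_pow h, mul_zero, zero_mul]

theorem sum_DD (q X Y : R) (hn : 1 ≤ n) :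
    ∑ k ∈ range ((n - 1) / 2 + 1), (∑ σ ∈ DD n k, q ^ (2 * pat2_13 σ + pat31_2 σ)) *
        X ^ k * Y ^ (n - 1 - 2 * k) =
      (slotStep q (q ^ 2) (noDDWeight X Y))^[n] (Pi.single 0 1) 1 := by
  let S : Finset (Equiv.Perm (Fin n)) := {σ | dd σ = 0}
  have hDD (k : ℕ) : DD n k = {σ ∈ S | des σ = k} := by
    rw [DD, filter_filter]
    exact filter_congr fun σ _ => and_comm
  have hmaps : ∀ σ ∈ S, des σ ∈ range ((n - 1) / 2 + 1) := fun σ hσ => by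
    have := two_mul_des_add σ hn (mem_filter.1 hσ).2
    rw [mem_range]
    omega
  simp only [← sum_prod_shape _ _ _ hn, prod_noDDWeight _ X Y hn, ite_mul, zero_mul]
  rw [← sum_filter, ← sum_fiberwise_of_maps_to hmaps]
  refine sum_congr rfl fun k _ => ?_
  rw [sum_mul, sum_mul, hDD]
  refine sum_congr rfl fun σ hσ => ?_
  rw [(mem_filter.1 hσ).2]
  ring

end Shape

section Comparison

variable {R : Type*} [CommSemiring R] (q t : R)

theorem prod_pow_mul_rowStep_colStep {F G : ℕ → R} (hG : G 0 = 0)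
    (h : ∀ k, (∏ i ∈ range k, q ^ (i + 1)) * F k = (∏ i ∈ range k, qInt 1 q (i + 1)) * G (k + 1))
    (k : ℕ) :
    (∏ i ∈ range k, q ^ (i + 1)) * rowStep q t (colStep q F) k =
      (∏ i ∈ range k, qInt 1 q (i + 1)) *
        slotStep q (q ^ 2) (noDDWeight t (1 + t)) G (k + 1) := by
  have hprev : (∏ i ∈ range k, q ^ (i + 1)) * (qInt 1 q k * F (k - 1)) =
      q ^ k * ((∏ i ∈ range k, qInt 1 q (i + 1)) * G k) := by
    obtain _ | k := k
    · simp [qInt, hG]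
    · calc
        _ = q ^ (k + 1) * qInt 1 q (k + 1) * ((∏ i ∈ range k, q ^ (i + 1)) * F k) := by
          rw [prod_range_succ, Nat.add_sub_cancel]
          ring
        _ = _ := by
          rw [h, prod_range_succ]
          ring
  calc
    _ = qInt 1 q (k + 1) * ((∏ i ∈ range k, q ^ (i + 1)) * (qInt 1 q k * F (k - 1))) +
          (1 + t) * q ^ k * qInt 1 q (k + 1) * ((∏ i ∈ range k, q ^ (i + 1)) * F k) +
          t * q ^ k * ((∏ i ∈ range (k + 1), q ^ (i + 1)) * F (k + 1)) := by
      simp only [rowStep, colStep, prod_range_succ, Nat.add_sub_cancel]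
      ring
    _ = _ := by
      rw [hprev, h, h, prod_range_succ, slotStep, qInt_sq, Nat.add_sub_cancel]
      simp only [noDDWeight]
      ring

theorem prod_pow_mul_iterate_rowStep (n k : ℕ) :
    (∏ i ∈ range k, q ^ (i + 1)) * rowStep q t ((colStep q ∘ rowStep q t)^[n] (Pi.single 0 1)) k =
      (∏ i ∈ range k, qInt 1 q (i + 1)) *
        (slotStep q (q ^ 2) (noDDWeight t (1 + t)))^[n + 1] (Pi.single 0 1) (k + 1) := by
  induction n generalizing k with
  | zero => cases k <;> simp [rowStep, slotStep, qInt, noDDWeight]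
  | succ n ih =>
    rw [Function.iterate_succ_apply', Function.iterate_succ_apply' _ (n + 1)]
    refine prod_pow_mul_rowStep_colStep q t ?_ ih k
    rw [Function.iterate_succ_apply', slotStep, qInt, zero_mul]

theorem iterate_colStep_rowStep_zero {n : ℕ} (hn : 1 ≤ n) :
    (colStep q ∘ rowStep q t)^[n] (Pi.single 0 1) 0 =
      (slotStep q (q ^ 2) (noDDWeight t (1 + t)))^[n] (Pi.single 0 1) 1 := by
  obtain ⟨n, rfl⟩ := Nat.exists_eq_add_of_le' hn
  have h := prod_pow_mul_iterate_rowStep q t n 0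
  rw [range_zero, prod_empty, prod_empty, one_mul, one_mul] at h
  rw [← h, Function.iterate_succ_apply', Function.comp_apply, colStep, qInt]
  simp

end Comparison

end PermStat

/-- The identity is stated for elements `q`, `t` of an arbitrary commutative semiring, which
includes the case of two indeterminates. -/
theorem theorem1p1 {R : Type*} [CommSemiring R] (q t : R) (n : ℕ) (hn : 1 ≤ n) :
    ∑ σ : Equiv.Perm (Fin n),
        q ^ (PermStat.inv σ - PermStat.exc σ) * t ^ PermStat.exc σ =
      ∑ k ∈ Finset.range ((n - 1) / 2 + 1),
        (∑ σ ∈ PermStat.DD n k, q ^ (2 * PermStat.pat2_13 σ + PermStat.pat31_2 σ)) *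
          t ^ k * (1 + t) ^ (n - 1 - 2 * k) := by
  rw [PermStat.sum_inv_exc, PermStat.sum_DD q t (1 + t) hn,
    PermStat.iterate_colStep_rowStep_zero q t hn]
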